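/- Let $\mathbb F$ be a field of characteristic $p>0$ and let $\mathfrak g$ be a restricted Lie algebra over $\mathbb F$ (not necessarily finite dimensional), with $p$-operator $g\mapsto g^{[p]}$. Write $[g_1,\dots,g_k]=[\cdots[[g_1,g_2],g_3]\cdots,g_k]$ and, for $g\in\mathfrak g$ acting by the adjoint action, $g\cdot m=[g,m]$. Below, $\sum\nolimits'$ denotes the sum over all words $g_1,\dots,g_p$ with each $g_j\in\{g,h\}$ and $g_1=g$, $g_2=h$, and $\#(g)$ is the number of letters equal to $g$; thus the $p$-operator satisfies $(\lambda g)^{[p]}=\lambda^pg^{[p]}$, $(g+h)^{[p]}=g^{[p]}+h^{[p]}+\sum\nolimits'\frac1{\#(g)}[g_1,\dots,g_p]$ and $[g,h^{[p]}]=[g,\underbrace{h,\dots,h}_p]$. A restricted infinitesimal deformation of $\mathfrak g$ is a pair $(\varphi,\omega)$ of a skew-symmetric bilinear map $\varphi:\mathfrak g\times\mathfrak g\to\mathfrak g$ (with $\varphi(g,g)=0$) and a map $\omega:\mathfrak g\to\mathfrak g$ such that $[g,h]_t=[g,h]+t\varphi(g,h)$ and $g^{[p]_t}=g^{[p]}+t\omega(g)$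 satisfy the axioms of a restricted Lie algebra modulo $t^2$, i.e. for all elements of $\mathfrak g$ and scalars in $\mathbb F$ the axioms hold in $\mathbb F[t]/(t^2)\otimes\mathfrak g$, with $[\cdot,\cdot]_t$ extended $\mathbb F[t]/(t^2)$-bilinearly. Two deformations $(\varphi_1,\omega_1)$, $(\varphi_2,\omega_2)$ are equivalent if there is a linear map $\psi:\mathfrak g\to\mathfrak g$ with $$\varphi_1(g,h)-\varphi_2(g,h)=\psi([g,h])-[g,\psi(h)]+[h,\psi(g)],\qquad \omega_1(g)-\omega_2(g)=\psi(g^{[p]})-[\psi(g),\underbrace{g,\dots,g}_{p-1}].$$ Let $C^1(\mathfrak g;\mathfrak g)=\mathrm{Hom}_{\mathbb F}(\mathfrak g,\mathfrak g)$ and let $C^2(\mathfrak g;\mathfrak g)$ be the space of pairs $(\varphi,\omega)$ with $\varphi:\Lambda^2\mathfrak g\to\mathfrak g$ linear and $\omega:\mathfrak g\to\mathfrak g$ a map satisfying $\omega(\lambda g)=\lambda^p\omega(g)$ and $$\omega(g+h)=\omega(g)+\omega(h)+\sum\nolimits'\frac1{\#(g)}\sum_{k=0}^{p-2}(-1)^kg_p\cdots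 g_{p-k+1}\cdot\varphi([g_1,\dots,g_{p-k-1}],g_{p-k}).$$ Let $\delta_{\rm cl}$ be the Chevalley–Eilenberg coboundary with adjoint coefficients, with the signs $\delta_{\rm cl}\psi(g,h)=\psi([g,h])-[g,\psi(h)]+[h,\psi(g)]$. Put $\delta^1\psi=(\delta_{\rm cl}\psi,\tilde\psi)$ with $\tilde\psi(g)=\psi(g^{[p]})-g^{p-1}\cdot\psi(g)$, and $\delta^2(\varphi,\omega)=(\delta_{\rm cl}\varphi,\beta)$ with $$\beta(g,h)=\varphi(g,h^{[p]})-\sum_{i+j=p-1}(-1)^ih^i\cdot\varphi([g,\underbrace{h,\dots,h}_j],h)+[g,\omega(h)],$$ and let $H^2(\mathfrak g;\mathfrak g)=\ker\delta^2/\operatorname{im}\delta^1$. **Theorem.** Every restricted infinitesimal deformation $(\varphi,\omega)$ of $\mathfrak g$ lies in $\ker\delta^2\subset C^2(\mathfrak g;\mathfrak g)$, and sending the equivalence class of $(\varphi,\omega)$ to its class in $H^2(\mathfrak g;\mathfrak g)$ is a well-defined bijection from the set of equivalence classes of restricted infinitesimal deformations of $\mathfrak g$ onto $H^2(\mathfrak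 g;\mathfrak g)$. -/

import Mathlib

set_option maxSynthPendingDepth 3

namespace RestrictedLie

/-! ### Iterated brackets and restricted Lie algebras -/

/-- The iterated (left-normed) bracket `[x₁, x₂, …, xₙ] = [⋯[[x₁ x₂] x₃]⋯ xₙ]` of the first `n ≥ 1`
terms of the sequence `x₁, x₂, …`, for a given bracket `br`; the value at `n = 0` is never used. -/
def iterBracket {V : Type*} [Zero V] (br : V → V → V) (x : ℕ → V) : ℕ → V
  | 0 => 0
  | 1 => x 1
  | n + 2 => br (iterBracket br x (n + 1)) (x (n + 2))

/-- The word `g₁, g₂, …` with `g_j = g` for `j ∈ S` and `g_j = h` for `j ∉ S`. -/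
def word {V : Type*} (S : Finset ℕ) (g h : V) (j : ℕ) : V := if j ∈ S then g else h

/-- The words `g₁ ⋯ g_p` in `g` and `h` with `g₁ = g` and `g₂ = h`, each given by the set
`S ⊆ {1, …, p}` of the positions of `g`; the number `#(g)` of letters `g` is `S.card`. -/
def wordSets (p : ℕ) : Finset (Finset ℕ) :=
  (Finset.Icc 1 p).powerset.filter fun S => 1 ∈ S ∧ 2 ∉ S

/-- `∑ 1/#(g) • [g₁, …, g_p]`, the sum over all words in `g` and `h` with `g₁ = g`, `g₂ = h`. -/
def jacobsonSum (F : Type*) [Field F] (p : ℕ) {V : Type*} [AddCommGroup V] [Module F V]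
    (br : V → V → V) (g h : V) : V :=
  ∑ S ∈ wordSets p, (S.card : F)⁻¹ • iterBracket br (word S g h) p

/-- `P : g ↦ g^[p]` is a `p`-operator on the Lie algebra `L`, that is, it makes `L` a restricted
Lie algebra. -/
structure IsPOperator (F : Type*) [Field F] (p : ℕ) {L : Type*} [LieRing L] [LieAlgebra F L]
    (P : L → L) : Prop where
  map_smul : ∀ (a : F) (g : L), P (a • g) = a ^ p • P g
  map_add : ∀ g h : L, P (g + h) = P g + P h + jacobsonSum F p (fun x y => ⁅x, y⁆) g h
  lie_map : ∀ g h : L, ⁅g, P h⁆ = (fun x => ⁅x, h⁆)^[p] g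

/-! ### Restricted infinitesimal deformations -/

section Deformation

variable {F : Type*} [Field F] {L : Type*} [LieRing L] [LieAlgebra F L]

/-- The bracket `[g h]_t = [g h] + t φ(g, h)` modulo `t²`, extended `F[t]/(t²)`-bilinearly to
`(F[t]/(t²)) ⊗ L`. The pair `(a, b) : L × L` stands for `a + t b`. -/
def deformedBracket (φ : L →ₗ[F] L →ₗ[F] L) (x y : L × L) : L × L :=
  (⁅x.1, y.1⁆, ⁅x.1, y.2⁆ + ⁅x.2, y.1⁆ + φ x.1 y.1)

/-- The deformed operator `g^[p]_t = g^[p] + t ω(g)` on `L`, with values in `(F[t]/(t²)) ⊗ L`. -/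
def deformedPow (P ω : L → L) (g : L) : L × L := (P g, ω g)

/-- `(φ, ω)` is a restricted infinitesimal deformation of the Lie algebra `L` with `p`-operator
`P`: modulo `t²`, the operations `[g h] + t φ(g, h)` and `g^[p] + t ω(g)` satisfy the axioms of a
restricted Lie algebra on `L`. The field `self` says `[g g]_t = 0`, that is, `φ(g, g) = 0`. -/
structure IsRestrictedDeformation (p : ℕ) (P : L → L) (c : (L →ₗ[F] L →ₗ[F] L) × (L → L)) :
    Prop where
  self : ∀ g : L, deformedBracket c.1 (g, 0) (g, 0) = 0
  jacobi : ∀ f g h : L,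
    deformedBracket c.1 (f, 0) (deformedBracket c.1 (g, 0) (h, 0)) +
      deformedBracket c.1 (g, 0) (deformedBracket c.1 (h, 0) (f, 0)) +
      deformedBracket c.1 (h, 0) (deformedBracket c.1 (f, 0) (g, 0)) = 0
  pow_smul : ∀ (a : F) (g : L), deformedPow P c.2 (a • g) = a ^ p • deformedPow P c.2 g
  pow_add : ∀ g h : L, deformedPow P c.2 (g + h) =
    deformedPow P c.2 g + deformedPow P c.2 h + jacobsonSum F p (deformedBracket c.1) (g, 0) (h, 0)
  bracket_pow : ∀ g h : L, deformedBracket c.1 (g, 0) (deformedPow P c.2 h) =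
    (fun x => deformedBracket c.1 x (h, 0))^[p] (g, 0)

variable (F)

/-- The type of restricted infinitesimal deformations of `L` with `p`-operator `P`. -/
def RestrictedDeformation (p : ℕ) (P : L → L) : Type _ :=
  {c : (L →ₗ[F] L →ₗ[F] L) × (L → L) // IsRestrictedDeformation p P c}

/-- Equivalence of restricted infinitesimal deformations: there is a linear `ψ : L → L` with
`φ₁(g, h) - φ₂(g, h) = ψ[g h] - [g ψ(h)] + [h ψ(g)]` and
`ω₁(g) - ω₂(g) = ψ(g^[p]) - [ψ(g), g, …, g]` (with `p - 1` entries `g`). -/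
def deformationSetoid (p : ℕ) (P : L → L) : Setoid (RestrictedDeformation F p P) where
  r c₁ c₂ := ∃ ψ : L →ₗ[F] L,
    (∀ g h : L, c₁.1.1 g h - c₂.1.1 g h = ψ ⁅g, h⁆ - ⁅g, ψ h⁆ + ⁅h, ψ g⁆) ∧
    (∀ g : L, c₁.1.2 g - c₂.1.2 g = ψ (P g) - (fun x => ⁅x, g⁆)^[p - 1] (ψ g))
  iseqv := by
    have key : ∀ (n : ℕ) (g x : L),
        (fun x => ⁅x, g⁆)^[n] x = ((-LieAlgebra.ad F L g) ^ n) x := by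
      intro n g x
      rw [Module.End.pow_apply]
      congr 2
      funext y
      simp
    refine ⟨fun c => ⟨0, ?_, ?_⟩, ?_, ?_⟩
    · intro g h; simp
    · intro g; simp [key]
    · rintro c₁ c₂ ⟨ψ, h₁, h₂⟩
      refine ⟨-ψ, fun g h => ?_, fun g => ?_⟩
      · rw [← neg_sub, h₁]; simp only [LinearMap.neg_apply, lie_neg]; abel
      · rw [← neg_sub, h₂]; simp [key]; abel
    · rintro c₁ c₂ c₃ ⟨ψ, h₁, h₂⟩ ⟨θ, h₃, h₄⟩
      refine ⟨ψ + θ, fun g h => ?_, fun g => ?_⟩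
      · rw [← sub_add_sub_cancel _ (c₂.1.1 g h), h₁, h₃]; simp; abel
      · rw [← sub_add_sub_cancel _ (c₂.1.2 g), h₂, h₄]; simp [key]; abel

end Deformation

/-! ### Restricted cohomology -/

section Cohomology

variable {F : Type*} [Field F] {L : Type*} [LieRing L] [LieAlgebra F L]
variable {M : Type*} [AddCommGroup M] [Module F M] [LieRingModule L M] [LieModule F L M]

/-- The operator `m ↦ xₙ xₙ₋₁ ⋯ x_{n-k+1} m` on `M` (with `k` factors). -/
def leftAct (F : Type*) [Field F] {L : Type*} [LieRing L] [LieAlgebra F L]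
    (M : Type*) [AddCommGroup M] [Module F M] [LieRingModule L M] [LieModule F L M]
    (x : ℕ → L) (n : ℕ) : ℕ → (M →ₗ[F] M)
  | 0 => LinearMap.id
  | k + 1 => leftAct F M x n k ∘ₗ LieModule.toEnd F L M (x (n - k))

/-- The sum in the `*`-property: over the words in `g` and `h` with `g₁ = g`, `g₂ = h`, of
`1/#(g) ∑_{k=0}^{p-2} (-1)^k g_p ⋯ g_{p-k+1} φ([g₁, …, g_{p-k-1}], g_{p-k})`. -/
def starSum (p : ℕ) (φ : L →ₗ[F] L →ₗ[F] M) (g h : L) : M :=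
  ∑ S ∈ wordSets p, (S.card : F)⁻¹ • ∑ k ∈ Finset.range (p - 1),
    (-1 : F) ^ k • leftAct F M (word S g h) p k
      (φ (iterBracket (fun x y => ⁅x, y⁆) (word S g h) (p - k - 1)) (word S g h (p - k)))

/-- `ω` has the `*`-property with respect to `φ`. -/
def HasStarProperty (p : ℕ) (φ : L →ₗ[F] L →ₗ[F] M) (ω : L → M) : Prop :=
  (∀ (a : F) (g : L), ω (a • g) = a ^ p • ω g) ∧
  ∀ g h : L, ω (g + h) = ω g + ω h + starSum p φ g h

variable (F L M)

/-- The space `C²(L; M)` of restricted 2-cochains: the pairs `(φ, ω)` of a skew-symmetric bilinear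
map `φ` (`φ(g, g) = 0`) and a map `ω` that has the `*`-property with respect to `φ`. -/
def restrictedC2 (p : ℕ) : Submodule F ((L →ₗ[F] L →ₗ[F] M) × (L → M)) where
  carrier := {c | (∀ g, c.1 g g = 0) ∧ HasStarProperty p c.1 c.2}
  zero_mem' := by
    refine ⟨fun g => by simp, fun a g => by simp, fun g h => ?_⟩
    simp [starSum]
  add_mem' := by
    rintro c d ⟨hc₀, hc₁, hc₂⟩ ⟨hd₀, hd₁, hd₂⟩
    refine ⟨fun g => by simp [hc₀, hd₀], fun a g => by simp [hc₁, hd₁], fun g h => ?_⟩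
    have : starSum p (c.1 + d.1) g h = starSum p c.1 g h + starSum p d.1 g h := by
      simp [starSum, Finset.sum_add_distrib]
    simp only [Prod.fst_add, Prod.snd_add, Pi.add_apply, hc₂, hd₂, this]
    abel
  smul_mem' := by
    rintro b c ⟨hc₀, hc₁, hc₂⟩
    refine ⟨fun g => by simp [hc₀], fun a g => by simp [hc₁, smul_comm b], fun g h => ?_⟩
    have : starSum p (b • c.1) g h = b • starSum p c.1 g h := by
      simp [starSum, Finset.smul_sum, smul_comm b]
    simp only [Prod.smul_fst, Prod.smul_snd, Pi.smul_apply, hc₂, this, smul_add]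

/-- The Chevalley-Eilenberg coboundary `δ_cl ψ (g, h) = -g ψ(h) + h ψ(g) + ψ([g h])`. -/
def deltaCl1 : (L →ₗ[F] M) →ₗ[F] (L →ₗ[F] L →ₗ[F] M) where
  toFun ψ := LinearMap.mk₂ F (fun g h => -⁅g, ψ h⁆ + ⁅h, ψ g⁆ + ψ ⁅g, h⁆)
    (fun _ _ _ => by simp; abel) (fun _ _ _ => by simp [smul_add])
    (fun _ _ _ => by simp; abel) (fun _ _ _ => by simp [smul_add])
  map_add' _ _ := by ext; simp; abel
  map_smul' _ _ := by ext; simp [smul_add]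

/-- The coboundary `δ¹ ψ = (δ_cl ψ, ψ̃)` on `C¹(L; M) = Hom(L, M)`, where
`ψ̃(g) = ψ(g^[p]) - g^{p-1} ψ(g)`. -/
def delta1 (p : ℕ) (P : L → L) : (L →ₗ[F] M) →ₗ[F] ((L →ₗ[F] L →ₗ[F] M) × (L → M)) :=
  LinearMap.prod (deltaCl1 F L M)
    { toFun := fun ψ g => ψ (P g) - ((LieModule.toEnd F L M g) ^ (p - 1)) (ψ g)
      map_add' := by intro ψ θ; funext g; simp; abel
      map_smul' := by intro a ψ; funext g; simp [smul_sub] }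

/-- The Chevalley-Eilenberg coboundary `δ_cl φ` of a bilinear map `φ`. -/
def deltaCl2 : (L →ₗ[F] L →ₗ[F] M) →ₗ[F] (L → L → L → M) where
  toFun φ g h f := φ ⁅g, h⁆ f - φ ⁅g, f⁆ h + φ ⁅h, f⁆ g - ⁅g, φ h f⁆ + ⁅h, φ g f⁆ - ⁅f, φ g h⁆
  map_add' _ _ := by funext g h f; simp; abel
  map_smul' _ _ := by funext g h f; simp [smul_add, smul_sub]

/-- The coboundary `δ² (φ, ω) = (δ_cl φ, β)`, where `β(g, h) =
φ(g, h^[p]) - ∑_{i+j=p-1} (-1)^i h^i φ([g, h, …, h], h) + g ω(h)` with `j = p - 1 - i` entries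
`h` in the iterated bracket. Only its kernel on `C²(L; M)` matters, so the codomain is not cut down
to the space of 3-cochains. -/
def delta2 (p : ℕ) (P : L → L) : ((L →ₗ[F] L →ₗ[F] M) × (L → M)) →ₗ[F]
    ((L → L → L → M) × (L → L → M)) :=
  LinearMap.prod (deltaCl2 F L M ∘ₗ LinearMap.fst F _ _)
    { toFun := fun c g h => c.1 g (P h)
        - ∑ i ∈ Finset.range p, (-1 : F) ^ i •
            ((LieModule.toEnd F L M h) ^ i) (c.1 ((fun x => ⁅x, h⁆)^[p - 1 - i] g) h)
        + ⁅g, c.2 h⁆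
      map_add' := by
        intro c d; funext g h
        simp [Finset.sum_add_distrib]
        abel
      map_smul' := by
        intro a c; funext g h
        simp [smul_sub, smul_add, Finset.smul_sum, smul_comm a] }

/-- The restricted 2-cocycles: the kernel of `δ²` on `C²(L; M)`. -/
def restrictedZ2 (p : ℕ) (P : L → L) : Submodule F ((L →ₗ[F] L →ₗ[F] M) × (L → M)) :=
  restrictedC2 F L M p ⊓ LinearMap.ker (delta2 F L M p P)

/-- The restricted 2-coboundaries: the image of `δ¹`. -/
def restrictedB2 (p : ℕ) (P : L → L) : Submodule F ((L →ₗ[F] L →ₗ[F] M) × (L → M)) :=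
  LinearMap.range (delta1 F L M p P)

/-- The restricted cohomology space `H²(L; M) = ker δ² / im δ¹`. (`submoduleOf` regards `im δ¹` as a
submodule of `ker δ²`, in which it is contained when `P` is a `p`-operator and `M` is a restricted
module, e.g. for `M = L` with the adjoint action.) -/
abbrev restrictedH2 (p : ℕ) (P : L → L) : Type _ :=
  restrictedZ2 F L M p P ⧸ (restrictedB2 F L M p P).submoduleOf (restrictedZ2 F L M p P)

end Cohomology

end RestrictedLie

namespace RestrictedLie

/-! Each deformation axiom is an identity in `L × L`, read as constant term and coefficient of t.
For the axioms on the p-operator and for Jacobi, the constant term is an axiom already valid in `L`,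
so only the t-coefficient imposes a condition. Modulo t² an iterated bracket uses φ at most once.
Summing over the place where it is used, with each later right bracketing turned into a left action
at the cost of a sign, gives exactly the sums in the *-property and in β
(`iterBracket_deformedBracket`, `iterate_deformedBracket`). Hence deformations and restricted
2-cocycles are the same pairs. Equivalence is congruence modulo im δ¹, because (-1)^(p-1) = 1 in
characteristic p. The two quotients therefore coincide. -/

section Expansion

variable {F : Type*} [Field F] {L : Type*} [LieRing L] [LieAlgebra F L]

/-- The recursion for `leftAct` that splits off the outermost factor. -/
theorem leftAct_succ_succ {M : Type*} [AddCommGroup M] [Module F M] [LieRingModule L M]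
    [LieModule F L M] (x : ℕ → L) (n k : ℕ) (m : M) :
    leftAct F M x (n + 1) (k + 1) m = ⁅x (n + 1), leftAct F M x n k m⁆ := by
  induction k generalizing m with
  | zero => simp [leftAct]
  | succ k ih =>
    rw [leftAct, LinearMap.comp_apply, ih, Nat.add_sub_add_right, leftAct, LinearMap.comp_apply]

/-- The expansion modulo `t²` of an iterated deformed bracket of elements of `L`. -/
theorem iterBracket_deformedBracket (φ : L →ₗ[F] L →ₗ[F] L) (x : ℕ → L) (n : ℕ) :
    iterBracket (deformedBracket φ) (fun j => (x j, 0)) (n + 1) =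
      (iterBracket (fun a b => ⁅a, b⁆) x (n + 1), ∑ k ∈ Finset.range n,
        (-1 : F) ^ k • leftAct F L x (n + 1) k
          (φ (iterBracket (fun a b => ⁅a, b⁆) x (n + 1 - k - 1)) (x (n + 1 - k)))) := by
  induction n with
  | zero => simp [iterBracket]
  | succ n ih =>
    -- The split-off term k = 0 is the one where φ replaces the last bracket; the others come from
    -- the inductive hypothesis with k shifted by one.
    rw [iterBracket, ih, deformedBracket, Finset.sum_range_succ']
    refine Prod.ext rfl ?_
    have hzero (m : L) : leftAct F L x (n + 1 + 1) 0 m = m := rfl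
    simp only [lie_zero, zero_add, pow_zero, one_smul, hzero, Nat.sub_zero, Nat.add_sub_cancel]
    refine congrArg₂ _ ?_ rfl
    rw [← lie_skew, lie_sum, ← Finset.sum_neg_distrib]
    refine Finset.sum_congr rfl fun k _ => ?_
    rw [leftAct_succ_succ, Nat.add_sub_add_right, lie_smul, pow_succ, mul_neg_one, neg_smul]

/-- The expansion modulo `t²` of the iterated deformed bracket `[g, h, …, h]_t`. -/
theorem iterate_deformedBracket (φ : L →ₗ[F] L →ₗ[F] L) (g h : L) (n : ℕ) :
    (fun x => deformedBracket φ x (h, 0))^[n] (g, 0) =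
      ((fun x => ⁅x, h⁆)^[n] g, ∑ i ∈ Finset.range n, (-1 : F) ^ i •
        ((LieModule.toEnd F L L h) ^ i) (φ ((fun x => ⁅x, h⁆)^[n - 1 - i] g) h)) := by
  induction n with
  | zero => simp
  | succ n ih =>
    rw [Function.iterate_succ_apply', ih, deformedBracket, Finset.sum_range_succ']
    refine Prod.ext (by exact (Function.iterate_succ_apply' (fun x => ⁅x, h⁆) n g).symm) ?_
    simp only [lie_zero, zero_add, pow_zero, one_smul, Module.End.one_apply, Nat.sub_zero,
      Nat.add_sub_cancel]
    refine congrArg₂ _ ?_ rfl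
    -- Right bracketing by `h` is minus the left action, hence one more factor -1 per step.
    rw [← lie_skew, lie_sum, ← Finset.sum_neg_distrib]
    refine Finset.sum_congr rfl fun i _ => ?_
    rw [lie_smul, pow_succ, mul_neg_one, neg_smul, pow_succ' (LieModule.toEnd F L L h),
      Module.End.mul_apply, LieModule.toEnd_apply_apply, Nat.sub_sub, Nat.add_comm 1 i]

/-- Words in (g, 0) and (h, 0) are words in g and h embedded in `L × L`, so the expansion applies
termwise. The bound on `p` avoids the junk value of `iterBracket` at 0. -/
theorem jacobsonSum_deformedBracket {p : ℕ} (hp : 1 ≤ p) (φ : L →ₗ[F] L →ₗ[F] L) (g h : L) :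
    jacobsonSum F p (deformedBracket φ) (g, 0) (h, 0) =
      (jacobsonSum F p (fun a b => ⁅a, b⁆) g h, starSum p φ g h) := by
  obtain ⟨n, rfl⟩ := Nat.exists_eq_add_of_le' hp
  have hword (S : Finset ℕ) :
      word S ((g, 0) : L × L) (h, 0) = fun j => (word S g h j, 0) := by
    funext j
    by_cases hj : j ∈ S <;> simp [word, hj]
  simp only [jacobsonSum, starSum, hword, iterBracket_deformedBracket, Nat.add_sub_cancel]
  refine Prod.ext ?_ ?_
  · simp [Prod.fst_sum]
  · simp [Prod.snd_sum]

/-- The Jacobi identity modulo `t²` for a deformed bracket says that `φ` is a cocycle. -/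
theorem deformedBracket_jacobi_iff {φ : L →ₗ[F] L →ₗ[F] L} (hφ : ∀ g, φ g g = 0) (f g h : L) :
    deformedBracket φ (f, 0) (deformedBracket φ (g, 0) (h, 0)) +
        deformedBracket φ (g, 0) (deformedBracket φ (h, 0) (f, 0)) +
        deformedBracket φ (h, 0) (deformedBracket φ (f, 0) (g, 0)) = 0 ↔
      deltaCl2 F L L φ g h f = 0 := by
  have skew (a b : L) : φ a b = -φ b a := by
    have := hφ (a + b)
    simp only [map_add, LinearMap.add_apply, hφ, zero_add, add_zero] at this
    exact eq_neg_of_add_eq_zero_right this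
  -- Up to sign, δ_cl φ is the t-coefficient of the cyclic Jacobi sum.
  have key : deltaCl2 F L L φ g h f =
      -((⁅f, φ g h⁆ + φ f ⁅g, h⁆) + (⁅g, φ h f⁆ + φ g ⁅h, f⁆) + (⁅h, φ f g⁆ + φ h ⁅f, g⁆)) := by
    change φ ⁅g, h⁆ f - φ ⁅g, f⁆ h + φ ⁅h, f⁆ g - ⁅g, φ h f⁆ + ⁅h, φ g f⁆ - ⁅f, φ g h⁆ = _
    rw [skew ⁅g, h⁆ f, skew ⁅g, f⁆ h, skew ⁅h, f⁆ g, skew g f, ← lie_skew f g, map_neg, lie_neg]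
    abel
  rw [key, neg_eq_zero, Prod.ext_iff]
  simp [deformedBracket, lie_jacobi]

/-- The restricted infinitesimal deformations are exactly the restricted 2-cocycles. -/
theorem isRestrictedDeformation_iff_mem_restrictedZ2 {p : ℕ} (hp : 1 ≤ p) {P : L → L}
    (hP : IsPOperator F p P) (c : (L →ₗ[F] L →ₗ[F] L) × (L → L)) :
    IsRestrictedDeformation p P c ↔ c ∈ restrictedZ2 F L L p P := by
  obtain ⟨φ, ω⟩ := c
  have hself (g : L) : deformedBracket φ (g, 0) (g, 0) = 0 ↔ φ g g = 0 := by
    simp [deformedBracket]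
  have hsmul (a : F) (g : L) : deformedPow P ω (a • g) = a ^ p • deformedPow P ω g ↔
      ω (a • g) = a ^ p • ω g := by
    simp [deformedPow, hP.map_smul]
  have hadd (g h : L) : deformedPow P ω (g + h) = deformedPow P ω g + deformedPow P ω h +
      jacobsonSum F p (deformedBracket φ) (g, 0) (h, 0) ↔
      ω (g + h) = ω g + ω h + starSum p φ g h := by
    simp [deformedPow, jacobsonSum_deformedBracket hp, hP.map_add]
  have hpow (g h : L) : deformedBracket φ (g, 0) (deformedPow P ω h) =
      (fun x => deformedBracket φ x (h, 0))^[p] (g, 0) ↔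
      (delta2 F L L p P (φ, ω)).2 g h = 0 := by
    -- `lie_map` makes the constant terms cancel; what remains in the t-coefficient is β(g, h).
    rw [iterate_deformedBracket, ← hP.lie_map, ← sub_eq_zero, Prod.ext_iff]
    simp [deformedBracket, deformedPow, delta2]
    rw [add_sub_assoc, add_comm]
  have hker : (φ, ω) ∈ LinearMap.ker (delta2 F L L p P) ↔
      (∀ g h f, deltaCl2 F L L φ g h f = 0) ∧ ∀ g h, (delta2 F L L p P (φ, ω)).2 g h = 0 := by
    rw [LinearMap.mem_ker, Prod.ext_iff]
    simp only [funext_iff]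
    rfl
  rw [restrictedZ2, Submodule.mem_inf, hker]
  constructor
  · intro H
    have h0 : ∀ g, φ g g = 0 := fun g => (hself g).1 (H.self g)
    exact ⟨⟨h0, fun a g => (hsmul a g).1 (H.pow_smul a g), fun g h => (hadd g h).1 (H.pow_add g h)⟩,
      fun g h f => (deformedBracket_jacobi_iff h0 f g h).1 (H.jacobi f g h),
      fun g h => (hpow g h).1 (H.bracket_pow g h)⟩
  · rintro ⟨⟨h0, h1, h2⟩, h3, h4⟩
    exact ⟨fun g => (hself g).2 (h0 g),
      fun f g h => (deformedBracket_jacobi_iff h0 f g h).2 (h3 g h f),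
      fun a g => (hsmul a g).2 (h1 a g), fun g h => (hadd g h).2 (h2 g h),
      fun g h => (hpow g h).2 (h4 g h)⟩

/-- In characteristic `p`, right and left bracketing `p - 1` times with `g` agree. -/
theorem iterate_lie_right_eq_toEnd_pow (p : ℕ) [Fact p.Prime] [CharP F p] (g x : L) :
    (fun y => ⁅y, g⁆)^[p - 1] x = ((LieModule.toEnd F L L g) ^ (p - 1)) x := by
  have hsign : (-1 : F) ^ (p - 1) = 1 := by
    -- For p = 2 the sign is trivial since -1 = 1; for odd p the exponent is even.
    rcases (Fact.out : p.Prime).eq_two_or_odd' with rfl | hodd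
    · simpa using CharTwo.neg_eq (1 : F)
    · exact (hodd.tsub_odd odd_one).neg_one_pow
  have hfun : (fun y : L => ⁅y, g⁆) = ⇑((-1 : F) • LieModule.toEnd F L L g) := by
    funext y
    simp
  rw [hfun, ← Module.End.pow_apply, smul_pow, hsign, one_smul]

/-- Two deformations are equivalent if and only if they differ by a restricted coboundary. -/
theorem deformationSetoid_iff_sub_mem_restrictedB2 (p : ℕ) [Fact p.Prime] [CharP F p] (P : L → L)
    (c d : RestrictedDeformation F p P) :
    deformationSetoid F p P c d ↔ c.1 - d.1 ∈ restrictedB2 F L L p P := by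
  rw [restrictedB2, LinearMap.mem_range]
  refine exists_congr fun ψ => ?_
  rw [eq_comm, Prod.ext_iff, LinearMap.ext_iff₂, funext_iff]
  refine and_congr (forall₂_congr fun g h => ?_) (forall_congr' fun g => ?_)
  · change _ ↔ c.1.1 g h - d.1.1 g h = -⁅g, ψ h⁆ + ⁅h, ψ g⁆ + ψ ⁅g, h⁆
    rw [show -⁅g, ψ h⁆ + ⁅h, ψ g⁆ + ψ ⁅g, h⁆ = ψ ⁅g, h⁆ - ⁅g, ψ h⁆ + ⁅h, ψ g⁆ by abel]
  · rw [iterate_lie_right_eq_toEnd_pow (F := F)]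
    rfl

end Expansion

end RestrictedLie

theorem mainTheorem6 {F : Type*} [Field F] (p : ℕ) [Fact p.Prime] [CharP F p]
    {L : Type*} [LieRing L] [LieAlgebra F L] (P : L → L)
    (hP : RestrictedLie.IsPOperator F p P) :
    ∃ Φ : Quotient (RestrictedLie.deformationSetoid (L := L) F p P) ≃
        RestrictedLie.restrictedH2 F L L p P,
      ∀ D : RestrictedLie.RestrictedDeformation (L := L) F p P,
        ∃ hD : D.1 ∈ RestrictedLie.restrictedZ2 F L L p P,
          Φ (Quotient.mk _ D) = Submodule.Quotient.mk ⟨D.1, hD⟩ := by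
  have hZ := RestrictedLie.isRestrictedDeformation_iff_mem_restrictedZ2
    (Fact.out : p.Prime).one_le hP
  let e : RestrictedLie.RestrictedDeformation (L := L) F p P ≃
      RestrictedLie.restrictedZ2 F L L p P := Equiv.subtypeEquivRight hZ
  refine ⟨Quotient.congr e fun c d => ?_, fun D => ⟨(hZ D.1).1 D.2, rfl⟩⟩
  refine (RestrictedLie.deformationSetoid_iff_sub_mem_restrictedB2 p P c d).trans ?_
  -- `submoduleOf` is a preimage under the inclusion, so membership of the difference in it unfolds
  -- to membership in im δ¹; the inclusion of im δ¹ in ker δ² is not needed.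
  exact (Submodule.quotientRel_def ((RestrictedLie.restrictedB2 F L L p P).submoduleOf
    (RestrictedLie.restrictedZ2 F L L p P)) (x := e c) (y := e d)).symm
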